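/- A word is \emph{Carlitz} if adjacent letters are different, and \emph{ordered} if its letters appear for the first time in increasing order, i.e. for any two letters $a<b$ of the word the first occurrence of $a$ precedes the first occurrence of $b$. A word \emph{of} a multiset uses every element of the multiset exactly as often as its multiplicity; $i^k$ denotes $k$ copies of the letter $i$. Let the sequences $(p_n)_{n\ge 0}$, $(q_n)_{n\ge 0}$ of rational numbers be recursively defined by $p_0=1$, $p_1=0$, $q_0=0$ and, for all $n\ge 1$, $$2p_{n+1}=(3n+3)q_n-2(3n+1)p_n+2p_{n-1},\qquad q_n=(3n+2)p_n+2q_{n-1}.$$ Then for every $n\ge 0$, $p_n$ is the number of ordered Carlitz words of $1^3,2^3,\ldots,n^3$, and $q_n$ is the number of ordered Carlitz words of $0^2,1^3,2^3,\ldots,n^3$. Equivalently, these two counting sequences are the unique pair of sequences satisfying the initial conditions and the recurrences. -/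

import Mathlib

/-- A word is Carlitz if adjacent elements are different. -/
def IsCarlitz (w : List ℕ) : Prop :=
  w.IsChain (· ≠ ·)

/-- A word is ordered if its letters appear in order: for letters `a < b` of the word, the first
occurrence of `a` comes before the first occurrence of `b`. -/
def IsOrdered (w : List ℕ) : Prop :=
  ∀ a ∈ w, ∀ b ∈ w, a < b → w.idxOf a < w.idxOf b

/-- The ordered Carlitz words of a multiset `M` of letters, i.e. the arrangements of all the
elements of `M` (with multiplicity) that are ordered and Carlitz. -/
def orderedCarlitzWords (M : Multiset ℕ) : Set (List ℕ) :=
  {w | (w : Multiset ℕ) = M ∧ IsCarlitz w ∧ IsOrdered w}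

theorem orderedCarlitzWords_finite (M : Multiset ℕ) : (orderedCarlitzWords M).Finite := by
  induction M using Quotient.inductionOn with
  | h l =>
    refine (List.finite_toSet l.permutations).subset fun w hw => ?_
    exact List.mem_permutations.2 (Multiset.coe_eq_coe.1 hw.1)

/-- The multiset `1^3, 2^3, …, n^3` (three copies of each of `1, …, n`). -/
def triples (n : ℕ) : Multiset ℕ :=
  ∑ i ∈ Finset.Icc 1 n, Multiset.replicate 3 i

open Polynomial

/-! ### The functional `X ^ k ↦ k!` and the polynomials attached to multiplicities -/

/-! Let Φ(X^k) = k!, i.e. Φ(h) = ∫₀^∞ h(x)e^{-x} dx, so that Φ(h') = Φ(h) - h(0). Let ℓ_k be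
`letterPoly k`, so ℓ_{k+1}' = ℓ_k - ℓ_k'. Carlitz words with multiplicities m_i number Φ(∏ ℓ_{m_i}),
by induction on length: the words beginning with b number Φ of the product with ℓ_{m_b}
differentiated, and summing over b is the product rule; excluding a first letter is the recurrence
for ℓ.

With P = ℓ_3, a block of u triple letters that must first appear in a prescribed order contributes
P^u/u!. The resulting count `ncard_wordsFrom_and_wordsFromAfter` gives p_n = Φ(P^n)/n! and q_n =
Φ((X-1)P^n)/n!.

As RP^{n+1} vanishes at 0, Φ(RP^{n+1} - (RP^{n+1})') = 0 for every polynomial R. One choice of R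
yields each recurrence, and the recurrences with the initial values determine both sequences. -/

/-- The linear functional on polynomials sending `X ^ k` to `k!`. -/
noncomputable def factorialFunctional : ℚ[X] →ₗ[ℚ] ℚ :=
  Polynomial.lsum fun k => (k.factorial : ℚ) • LinearMap.id

theorem factorialFunctional_monomial (k : ℕ) (a : ℚ) :
    factorialFunctional (monomial k a) = k.factorial * a := by
  simp [factorialFunctional, Polynomial.lsum_apply, Polynomial.sum_monomial_index]

theorem factorialFunctional_one : factorialFunctional 1 = 1 := by
  rw [← monomial_zero_one, factorialFunctional_monomial]
  simp

/-- Integration by parts against e^{-x}; on monomials it is k·(k-1)! = k!, with the constant term as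
boundary value. -/
theorem factorialFunctional_derivative (h : ℚ[X]) :
    factorialFunctional (derivative h) = factorialFunctional h - h.eval 0 := by
  induction h using Polynomial.induction_on' with
  | add p q hp hq => simp only [map_add, eval_add, hp, hq]; ring
  | monomial k a =>
    rw [derivative_monomial, factorialFunctional_monomial, factorialFunctional_monomial]
    cases k with
    | zero => simp
    | succ k => simp [Nat.factorial_succ, eval_monomial]; ring

/-- The antiderivative of a polynomial vanishing at `0`. -/
noncomputable def antiderivative : ℚ[X] →ₗ[ℚ] ℚ[X] :=
  Polynomial.lsum fun k => ((k + 1 : ℚ)⁻¹) • monomial (k + 1)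

theorem antiderivative_monomial (k : ℕ) (a : ℚ) :
    antiderivative (monomial k a) = monomial (k + 1) ((k + 1 : ℚ)⁻¹ * a) := by
  simp [antiderivative, Polynomial.lsum_apply, Polynomial.sum_monomial_index, smul_monomial]

theorem derivative_antiderivative (h : ℚ[X]) : derivative (antiderivative h) = h := by
  induction h using Polynomial.induction_on' with
  | add p q hp hq => simp only [map_add, hp, hq]
  | monomial k a =>
    rw [antiderivative_monomial, derivative_monomial]
    have : (k + 1 : ℚ) ≠ 0 := by positivity
    congr 1
    push_cast
    field_simp

theorem eval_zero_antiderivative (h : ℚ[X]) : (antiderivative h).eval 0 = 0 := by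
  induction h using Polynomial.induction_on' with
  | add p q hp hq => simp only [map_add, eval_add, hp, hq, add_zero]
  | monomial k a => simp [antiderivative_monomial, eval_monomial]

/-- The (signed, generalized Laguerre) polynomial that a letter of multiplicity `k` contributes to
the enumeration of Carlitz words. -/
noncomputable def letterPoly : ℕ → ℚ[X]
  | 0 => 1
  | k + 1 => antiderivative (letterPoly k) - letterPoly k + C ((letterPoly k).eval 0)

/-- This identity encodes "all words minus those beginning with the letter". The constant added in
the definition does not affect it and makes every later polynomial vanish at 0. -/
theorem derivative_letterPoly_succ (k : ℕ) :
    derivative (letterPoly (k + 1)) = letterPoly k - derivative (letterPoly k) := by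
  simp [letterPoly, derivative_antiderivative]

theorem derivative_letterPoly_zero : derivative (letterPoly 0) = 0 := by
  simp [letterPoly]

theorem eval_zero_letterPoly {k : ℕ} (hk : k ≠ 0) : (letterPoly k).eval 0 = 0 := by
  cases k with
  | zero => exact absurd rfl hk
  | succ k => simp [letterPoly, eval_zero_antiderivative]

theorem letterPoly_one : letterPoly 1 = X := by
  have h : antiderivative 1 = X := by
    rw [← monomial_zero_one, antiderivative_monomial, ← monomial_one_one_eq_X]
    simp
  simp [letterPoly, h]

theorem antiderivative_X : antiderivative X = C (1 / 2) * X ^ 2 := by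
  rw [C_mul_X_pow_eq_monomial, ← monomial_one_one_eq_X, antiderivative_monomial]
  norm_num

theorem letterPoly_two : letterPoly 2 = C (1 / 2) * X ^ 2 - X := by
  rw [letterPoly, letterPoly_one, antiderivative_X]
  simp

theorem letterPoly_three : letterPoly 3 = C (1 / 6) * X ^ 3 - X ^ 2 + X := by
  have h₁ : antiderivative (C (1 / 2) * X ^ 2) = C (1 / 6) * X ^ 3 := by
    rw [C_mul_X_pow_eq_monomial, antiderivative_monomial, C_mul_X_pow_eq_monomial]
    norm_num
  have h₂ : (C (1 / 2) * X ^ 2 : ℚ[X]) + C (1 / 2) * X ^ 2 = X ^ 2 := by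
    rw [← add_mul, ← C_add]; norm_num
  rw [letterPoly, eval_zero_letterPoly two_ne_zero, letterPoly_two, map_sub, antiderivative_X, h₁,
    C_0]
  linear_combination -h₂

/-! ### Words in which only the large letters are ordered -/

/-- The letters of `w` that are at least `s` appear for the first time in increasing order. -/
def OrderedFrom (s : ℕ) (w : List ℕ) : Prop :=
  ∀ a ∈ w, ∀ b ∈ w, s ≤ a → a < b → w.idxOf a < w.idxOf b

theorem orderedFrom_cons_of_lt {s b : ℕ} {w : List ℕ} (hb : b < s) :
    OrderedFrom s (b :: w) ↔ OrderedFrom s w := by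
  constructor
  · intro h x hx y hy hsx hxy
    have := h x (List.mem_cons_of_mem _ hx) y (List.mem_cons_of_mem _ hy) hsx hxy
    rw [List.idxOf_cons_ne _ (by omega), List.idxOf_cons_ne _ (by omega)] at this
    omega
  · intro h x hx y hy hsx hxy
    rw [List.idxOf_cons_ne _ (by omega), List.idxOf_cons_ne _ (by omega)]
    have := h x ((List.mem_cons.1 hx).resolve_left (by omega)) y
      ((List.mem_cons.1 hy).resolve_left (by omega)) hsx hxy
    omega

/-- With `s` in first position every condition involving `s` is met, so `s` joins the unconstrained
letters. -/
theorem orderedFrom_cons_self {s : ℕ} {w : List ℕ} :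
    OrderedFrom s (s :: w) ↔ OrderedFrom (s + 1) w := by
  constructor
  · intro h x hx y hy hsx hxy
    have := h x (List.mem_cons_of_mem _ hx) y (List.mem_cons_of_mem _ hy) (by omega) hxy
    rw [List.idxOf_cons_ne _ (by omega), List.idxOf_cons_ne _ (by omega)] at this
    omega
  · intro h x hx y hy hsx hxy
    rcases hsx.eq_or_lt with rfl | hsx
    · rw [List.idxOf_cons_self, List.idxOf_cons_ne _ (by omega)]
      omega
    · rw [List.idxOf_cons_ne _ (by omega), List.idxOf_cons_ne _ (by omega)]
      have := h x ((List.mem_cons.1 hx).resolve_left (by omega)) y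
        ((List.mem_cons.1 hy).resolve_left (by omega)) hsx hxy
      omega

theorem not_orderedFrom_cons_of_gt {s b : ℕ} {w : List ℕ} (hb : s < b) (hs : s ∈ w) :
    ¬ OrderedFrom s (b :: w) := by
  intro h
  have := h s (List.mem_cons_of_mem _ hs) b List.mem_cons_self le_rfl hb
  simp at this

/-- The Carlitz words of `M` whose letters from `s` on are ordered. -/
def wordsFrom (s : ℕ) (M : Multiset ℕ) : Set (List ℕ) :=
  {w | (w : Multiset ℕ) = M ∧ IsCarlitz w ∧ OrderedFrom s w}

/-- The words in `wordsFrom s M` that do not begin with the letter `a`. -/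
def wordsFromAfter (s a : ℕ) (M : Multiset ℕ) : Set (List ℕ) :=
  {w | (w : Multiset ℕ) = M ∧ IsCarlitz (a :: w) ∧ OrderedFrom s w}

theorem wordsFrom_finite (s : ℕ) (M : Multiset ℕ) : (wordsFrom s M).Finite := by
  induction M using Quotient.inductionOn with
  | h l =>
    refine (List.finite_toSet l.permutations).subset fun w hw => ?_
    exact List.mem_permutations.2 (Multiset.coe_eq_coe.1 hw.1)

theorem ncard_eq_sum_ncard_tails {A : Set (List ℕ)} (hA : A.Finite) (t : Finset ℕ)
    (h : ∀ w ∈ A, ∃ b ∈ t, ∃ v, w = b :: v) :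
    A.ncard = ∑ b ∈ t, {v | b :: v ∈ A}.ncard := by
  classical
  have hcard : ∀ b, {v | b :: v ∈ A}.ncard = {w ∈ A | ∃ v, w = b :: v}.ncard := by
    intro b
    rw [← Set.ncard_image_of_injective _ (List.cons_injective (a := b))]
    congr 1
    ext w
    constructor
    · rintro ⟨v, hv, rfl⟩
      exact ⟨hv, v, rfl⟩
    · rintro ⟨hw, v, rfl⟩
      exact ⟨v, hw, rfl⟩
  simp_rw [hcard]
  have hunion : A = ⋃ b ∈ (t : Set ℕ), {w ∈ A | ∃ v, w = b :: v} := by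
    ext w
    simp only [Set.mem_iUnion, Set.mem_ofPred_eq, Finset.mem_coe]
    constructor
    · intro hw
      obtain ⟨b, hb, v, hv⟩ := h w hw
      exact ⟨b, hb, hw, v, hv⟩
    · rintro ⟨b, -, hw, -⟩
      exact hw
  conv_lhs => rw [hunion]
  rw [Set.Finite.ncard_biUnion t.finite_toSet (fun b _ => hA.subset (Set.sep_subset _ _)),
    finsum_mem_coe_finset]
  intro b _ c _ hbc
  refine Set.disjoint_left.2 ?_
  rintro w ⟨-, v, rfl⟩ ⟨-, v', hv'⟩
  exact hbc (List.cons.inj hv').1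

theorem cons_mem_wordsFrom_of_lt {s b : ℕ} {M : Multiset ℕ} {v : List ℕ} (hb : b < s) :
    b :: v ∈ wordsFrom s M ↔ b ∈ M ∧ v ∈ wordsFromAfter s b (M.erase b) := by
  simp only [wordsFrom, wordsFromAfter, Set.mem_ofPred_eq, orderedFrom_cons_of_lt hb,
    ← Multiset.cons_coe]
  constructor
  · rintro ⟨rfl, h⟩
    simpa using h
  · rintro ⟨hM, hv, h⟩
    exact ⟨by rw [hv, Multiset.cons_erase hM], h⟩

theorem cons_self_mem_wordsFrom {s : ℕ} {M : Multiset ℕ} {v : List ℕ} :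
    s :: v ∈ wordsFrom s M ↔ s ∈ M ∧ v ∈ wordsFromAfter (s + 1) s (M.erase s) := by
  simp only [wordsFrom, wordsFromAfter, Set.mem_ofPred_eq, orderedFrom_cons_self,
    ← Multiset.cons_coe]
  constructor
  · rintro ⟨rfl, h⟩
    simpa using h
  · rintro ⟨hM, hv, h⟩
    exact ⟨by rw [hv, Multiset.cons_erase hM], h⟩

theorem ncard_wordsFrom_eq_after_add (s a : ℕ) (M : Multiset ℕ) :
    (wordsFrom s M).ncard =
      (wordsFromAfter s a M).ncard + {v | a :: v ∈ wordsFrom s M}.ncard := by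
  have hsplit : wordsFrom s M =
      wordsFromAfter s a M ∪ List.cons a '' {v | a :: v ∈ wordsFrom s M} := by
    ext w
    constructor
    · intro hw
      by_cases h : ∃ v, w = a :: v
      · obtain ⟨v, rfl⟩ := h
        exact Or.inr ⟨v, hw, rfl⟩
      · refine Or.inl ⟨hw.1, ?_, hw.2.2⟩
        cases w with
        -- The empty word counts as not beginning with `a`.
        | nil => exact List.isChain_singleton a
        | cons b v =>
          exact List.isChain_cons_cons.2 ⟨fun hab => h ⟨v, by rw [hab]⟩, hw.2.1⟩
    · rintro (⟨h₁, h₂, h₃⟩ | ⟨v, hv, rfl⟩)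
      · exact ⟨h₁, List.IsChain.tail h₂, h₃⟩
      · exact hv
  have hdisj : Disjoint (wordsFromAfter s a M)
      (List.cons a '' {v | a :: v ∈ wordsFrom s M}) := by
    refine Set.disjoint_left.2 ?_
    rintro w ⟨-, h, -⟩ ⟨v, -, rfl⟩
    exact (List.isChain_cons_cons.1 h).1 rfl
  have hfin := wordsFrom_finite s M
  rw [hsplit] at hfin
  conv_lhs => rw [hsplit]
  rw [Set.ncard_union_eq hdisj (hfin.subset Set.subset_union_left)
      (hfin.subset Set.subset_union_right),
    Set.ncard_image_of_injective _ List.cons_injective]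

/-! ### Enumeration of the words -/

/-- Three copies of each of the `u` letters `s, s + 1, …, s + u - 1`. -/
def triplesFrom : ℕ → ℕ → Multiset ℕ
  | _, 0 => 0
  | s, u + 1 => Multiset.replicate 3 s + triplesFrom (s + 1) u

theorem triplesFrom_eq_sum (s u : ℕ) :
    triplesFrom s u = ∑ i ∈ Finset.Ico s (s + u), Multiset.replicate 3 i := by
  induction u generalizing s with
  | zero => simp [triplesFrom]
  | succ u ih =>
    rw [triplesFrom, ih, Finset.sum_eq_sum_Ico_succ_bot (Nat.lt_add_of_pos_right u.succ_pos),
      Nat.add_right_comm s 1 u, Nat.add_assoc s u 1]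

theorem triples_eq_triplesFrom (n : ℕ) : triples n = triplesFrom 1 n := by
  rw [triples, triplesFrom_eq_sum]
  congr 1
  ext i
  simp
  omega

theorem le_of_mem_triplesFrom {s u b : ℕ} (h : b ∈ triplesFrom s u) : s ≤ b := by
  rw [triplesFrom_eq_sum, Multiset.mem_sum] at h
  obtain ⟨i, hi, hb⟩ := h
  rw [Multiset.eq_of_mem_replicate hb]
  exact (Finset.mem_Ico.1 hi).1

theorem card_triplesFrom (s u : ℕ) : (triplesFrom s u).card = 3 * u := by
  induction u generalizing s with
  | zero => rfl
  | succ u ih => simp [triplesFrom, ih]; ring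

/-- The contribution of the `u` letters of multiplicity three that have not yet occurred. -/
noncomputable def unseenPoly (u : ℕ) : ℚ[X] := C ((u.factorial : ℚ)⁻¹) * letterPoly 3 ^ u

theorem derivative_unseenPoly_zero : derivative (unseenPoly 0) = 0 := by
  simp [unseenPoly]

/-- The factor 1/u! absorbs the exponent produced by differentiation: among the unseen letters only
the smallest may come next, so there is one choice and not u + 1. -/
theorem derivative_unseenPoly_succ (u : ℕ) :
    derivative (unseenPoly (u + 1)) = derivative (letterPoly 3) * unseenPoly u := by
  have h : ((u + 1).factorial : ℚ)⁻¹ * (u + 1) = (u.factorial : ℚ)⁻¹ := by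
    have : (u.factorial : ℚ) ≠ 0 := by positivity
    have : (u + 1 : ℚ) ≠ 0 := by positivity
    rw [Nat.factorial_succ]
    push_cast
    field_simp
  have h' : C (((u + 1).factorial : ℚ)⁻¹) * C ((u + 1 : ℚ)) = C ((u.factorial : ℚ)⁻¹) := by
    rw [← C_mul, h]
  rw [unseenPoly, unseenPoly, derivative_mul, derivative_C, derivative_pow_succ, ← h']
  ring

theorem eval_zero_unseenPoly_succ (u : ℕ) : (unseenPoly (u + 1)).eval 0 = 0 := by
  simp [unseenPoly, eval_zero_letterPoly]

/-- The contribution of the letters in `t`, with their multiplicities in `M`. -/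
noncomputable def seenPoly (t : Finset ℕ) (M : Multiset ℕ) : ℚ[X] :=
  ∏ b ∈ t, letterPoly (M.count b)

theorem derivative_seenPoly (t : Finset ℕ) (M : Multiset ℕ) :
    derivative (seenPoly t M) =
      ∑ b ∈ t, derivative (letterPoly (M.count b)) * seenPoly (t.erase b) M := by
  rw [seenPoly, derivative_prod_finset]
  exact Finset.sum_congr rfl fun b _ => mul_comm _ _

theorem seenPoly_eq_mul_erase {t : Finset ℕ} {a : ℕ} (ha : a ∈ t) (M : Multiset ℕ) :
    seenPoly t M = letterPoly (M.count a) * seenPoly (t.erase a) M :=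
  (Finset.mul_prod_erase t (fun b => letterPoly (M.count b)) ha).symm

theorem seenPoly_erase_erase (t : Finset ℕ) (b : ℕ) (M : Multiset ℕ) :
    seenPoly (t.erase b) (M.erase b) = seenPoly (t.erase b) M :=
  Finset.prod_congr rfl fun c hc => by rw [Multiset.count_erase_of_ne (Finset.ne_of_mem_erase hc)]

theorem seenPoly_zero (t : Finset ℕ) : seenPoly t 0 = 1 := by
  simp [seenPoly, letterPoly]

theorem eval_zero_seenPoly {t : Finset ℕ} {M : Multiset ℕ} {b : ℕ} (hb : b ∈ t) (hM : b ∈ M) :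
    (seenPoly t M).eval 0 = 0 := by
  rw [seenPoly_eq_mul_erase hb, eval_mul,
    eval_zero_letterPoly (Multiset.count_ne_zero.2 hM), zero_mul]

theorem wordsFrom_zero (s : ℕ) : wordsFrom s 0 = {[]} := by
  ext w
  simp only [wordsFrom, Multiset.coe_eq_zero, Set.mem_ofPred_eq, Set.mem_singleton_iff]
  constructor
  · exact fun h => h.1
  · rintro rfl
    exact ⟨rfl, List.isChain_nil, by simp [OrderedFrom]⟩

theorem exists_cons_of_mem_wordsFrom {s u : ℕ} {M : Multiset ℕ} (hM : ∀ b ∈ M, b < s)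
    (hne : M + triplesFrom s u ≠ 0) {w : List ℕ} (hw : w ∈ wordsFrom s (M + triplesFrom s u)) :
    ∃ b ∈ Finset.range (s + 1), ∃ v, w = b :: v := by
  obtain ⟨h₁, -, h₃⟩ := hw
  cases w with
  | nil => exact absurd h₁.symm hne
  | cons b v =>
    refine ⟨b, ?_, v, rfl⟩
    rw [Finset.mem_range]
    by_contra! hb
    have hb' : b ∈ M + triplesFrom s u := by rw [← h₁]; simp
    rcases Multiset.mem_add.1 hb' with h | h
    · have := hM b h
      omega
    · cases u with
      | zero => simp [triplesFrom] at h
      | succ u =>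
        have hs : s ∈ ((b :: v : List ℕ) : Multiset ℕ) := by
          rw [h₁]; simp [triplesFrom]
        have hs' : s ∈ v := (List.mem_cons.1 (Multiset.mem_coe.1 hs)).resolve_left (by omega)
        exact not_orderedFrom_cons_of_gt (by omega) hs' h₃

/-- The numbers of words with given seen letters `M` and `u` unseen letters of multiplicity three,
without and with a restriction on the first letter. -/
theorem ncard_wordsFrom_and_wordsFromAfter (N : ℕ) : ∀ (s u : ℕ) (M : Multiset ℕ),
    (∀ b ∈ M, b < s) → M.card + 3 * u = N →
    ((wordsFrom s (M + triplesFrom s u)).ncard : ℚ) =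
        factorialFunctional (seenPoly (Finset.range s) M * unseenPoly u) ∧
    ∀ a < s, ((wordsFromAfter s a (M + triplesFrom s u)).ncard : ℚ) =
        factorialFunctional (derivative (letterPoly (M.count a + 1)) *
          seenPoly ((Finset.range s).erase a) M * unseenPoly u) := by
  -- Both counts go together: tails of words of length N + 1 are restricted words of length N, and
  -- restricted words of length N + 1 come from the unrestricted ones by subtraction.
  induction N with
  | zero =>
    intro s u M hM hN
    obtain rfl : u = 0 := by omega
    obtain rfl : M = 0 := Multiset.card_eq_zero.1 (by omega)
    have hu : unseenPoly 0 = 1 := by simp [unseenPoly]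
    have hS : ((wordsFrom s (0 + triplesFrom s 0)).ncard : ℚ) = 1 := by
      simp [triplesFrom, wordsFrom_zero]
    refine ⟨by rw [hS, seenPoly_zero, hu, mul_one, factorialFunctional_one], fun a _ => ?_⟩
    have h := ncard_wordsFrom_eq_after_add s a (0 + triplesFrom s 0)
    have htail : {v | a :: v ∈ wordsFrom s (0 + triplesFrom s 0)} = ∅ := by
      ext v; simp [triplesFrom, wordsFrom_zero]
    rw [htail, Set.ncard_empty, add_zero] at h
    rw [← h, hS, seenPoly_zero, hu, mul_one, mul_one, Multiset.count_zero,
      derivative_letterPoly_succ, derivative_letterPoly_zero, sub_zero, letterPoly, factorialFunctional_one]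
  | succ N ih =>
    intro s u M hM hN
    have htail : ∀ b < s, ({v | b :: v ∈ wordsFrom s (M + triplesFrom s u)}.ncard : ℚ) =
        factorialFunctional (derivative (letterPoly (M.count b)) *
          seenPoly ((Finset.range s).erase b) M * unseenPoly u) := by
      intro b hb
      by_cases hbM : b ∈ M
      · have hset : {v | b :: v ∈ wordsFrom s (M + triplesFrom s u)} =
            wordsFromAfter s b (M.erase b + triplesFrom s u) := by
          ext v
          rw [Set.mem_ofPred_eq, cons_mem_wordsFrom_of_lt hb,
            Multiset.erase_add_left_pos _ hbM]
          simp [hbM]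
        have hcard : (M.erase b).card + 3 * u = N := by
          have := Multiset.card_erase_add_one hbM
          omega
        -- The shift by one in the restricted formula cancels the removed copy of `b`.
        have hcount : (M.erase b).count b + 1 = M.count b := by
          have := Multiset.count_pos.2 hbM
          rw [Multiset.count_erase_self]
          omega
        rw [hset, (ih s u (M.erase b) (fun c hc => hM c (Multiset.mem_of_mem_erase hc))
          hcard).2 b hb, hcount, seenPoly_erase_erase]
      · have hset : {v | b :: v ∈ wordsFrom s (M + triplesFrom s u)} = ∅ := by
          ext v
          rw [Set.mem_ofPred_eq, cons_mem_wordsFrom_of_lt hb]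
          have : b ∉ triplesFrom s u := fun h => by
            have := le_of_mem_triplesFrom h
            omega
          simp [hbM, this]
        -- An absent letter contributes ℓ_0' = 0, so the sum may run over all letters below `s`.
        rw [hset, Multiset.count_eq_zero.2 hbM, derivative_letterPoly_zero]
        simp
    have htail_self : ({v | s :: v ∈ wordsFrom s (M + triplesFrom s u)}.ncard : ℚ) =
        factorialFunctional (seenPoly (Finset.range s) M * derivative (unseenPoly u)) := by
      have hsM : s ∉ M := fun h => lt_irrefl s (hM s h)
      cases u with
      | zero =>
        have hset : {v | s :: v ∈ wordsFrom s (M + triplesFrom s 0)} = ∅ := by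
          ext v
          simp [cons_self_mem_wordsFrom, triplesFrom, hsM]
        rw [hset, derivative_unseenPoly_zero]
        simp
      | succ u =>
        -- Using `s` for the first time makes it a seen letter with two copies left; the unseen
        -- letters then start at `s + 1`.
        have hM' : (M + triplesFrom s (u + 1)).erase s =
            (M + Multiset.replicate 2 s) + triplesFrom (s + 1) u := by
          rw [Multiset.erase_add_right_neg _ hsM, triplesFrom,
            Multiset.erase_add_left_pos _ (by simp), Multiset.replicate_succ,
            Multiset.erase_cons_head, add_assoc]
        have hset : {v | s :: v ∈ wordsFrom s (M + triplesFrom s (u + 1))} =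
            wordsFromAfter (s + 1) s ((M + Multiset.replicate 2 s) + triplesFrom (s + 1) u) := by
          ext v
          rw [Set.mem_ofPred_eq, cons_self_mem_wordsFrom, hM']
          simp [triplesFrom]
        have hlt : ∀ b ∈ M + Multiset.replicate 2 s, b < s + 1 := by
          intro b hb
          rcases Multiset.mem_add.1 hb with h | h
          · exact (hM b h).trans (Nat.lt_succ_self s)
          · rw [Multiset.eq_of_mem_replicate h]
            exact Nat.lt_succ_self s
        have hseen : seenPoly ((Finset.range (s + 1)).erase s) (M + Multiset.replicate 2 s) =
            seenPoly (Finset.range s) M := by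
          rw [Finset.range_add_one, Finset.erase_insert (by simp)]
          refine Finset.prod_congr rfl fun c hc => ?_
          have : s ≠ c := (Finset.mem_range.1 hc).ne'
          rw [Multiset.count_add, Multiset.count_replicate, if_neg this, add_zero]
        have hcount : (M + Multiset.replicate 2 s).count s + 1 = 3 := by
          simp [Multiset.count_eq_zero.2 hsM]
        rw [hset, (ih (s + 1) u _ hlt (by simp; omega)).2 s (Nat.lt_succ_self s), hcount,
          hseen, derivative_unseenPoly_succ]
        congr 1
        ring
    have hne : M + triplesFrom s u ≠ 0 := by
      intro h
      have := congrArg Multiset.card h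
      rw [Multiset.card_add, card_triplesFrom, Multiset.card_zero] at this
      omega
    -- Some letter remains, so some factor vanishes at 0 and Φ does not change under
    -- differentiation.
    have heval : (seenPoly (Finset.range s) M * unseenPoly u).eval 0 = 0 := by
      rw [eval_mul]
      cases u with
      | zero =>
        obtain ⟨b, hb⟩ := Multiset.exists_mem_of_ne_zero (s := M) (by simpa [triplesFrom] using hne)
        rw [eval_zero_seenPoly (Finset.mem_range.2 (hM b hb)) hb, zero_mul]
      | succ u => rw [eval_zero_unseenPoly_succ, mul_zero]
    have hS : ((wordsFrom s (M + triplesFrom s u)).ncard : ℚ) =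
        factorialFunctional (seenPoly (Finset.range s) M * unseenPoly u) := by
      have hD := factorialFunctional_derivative (seenPoly (Finset.range s) M * unseenPoly u)
      rw [heval, sub_zero] at hD
      -- The split by first letter matches the product rule term by term; `s` accounts for the
      -- derivative of the unseen factor.
      rw [ncard_eq_sum_ncard_tails (wordsFrom_finite _ _) (Finset.range (s + 1))
        fun w hw => exists_cons_of_mem_wordsFrom hM hne hw, Nat.cast_sum,
        Finset.sum_range_succ, htail_self,
        Finset.sum_congr rfl fun b hb => htail b (Finset.mem_range.1 hb), ← hD,
        derivative_mul, derivative_seenPoly, Finset.sum_mul, map_add, map_sum]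
    refine ⟨hS, fun a ha => ?_⟩
    have h : ((wordsFrom s (M + triplesFrom s u)).ncard : ℚ) = _ :=
      congrArg Nat.cast (ncard_wordsFrom_eq_after_add s a (M + triplesFrom s u))
    rw [Nat.cast_add, htail a ha, hS, seenPoly_eq_mul_erase (Finset.mem_range.2 ha)] at h
    rw [← sub_eq_iff_eq_add.2 h, ← map_sub, derivative_letterPoly_succ]
    congr 1
    ring

/-! ### Specialization to the two families of words -/

theorem orderedFrom_zero {w : List ℕ} : OrderedFrom 0 w ↔ IsOrdered w := by
  simp [OrderedFrom, IsOrdered]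

theorem orderedCarlitzWords_triples (n : ℕ) :
    orderedCarlitzWords (triples n) = wordsFrom 1 (0 + triplesFrom 1 n) := by
  rw [zero_add, ← triples_eq_triplesFrom]
  ext w
  refine and_congr_right fun hw => and_congr_right fun _ => ?_
  constructor
  · exact fun h a ha b hb _ hab => h a ha b hb hab
  · intro h a ha b hb hab
    refine h a ha b hb ?_ hab
    rw [← Multiset.mem_coe, hw, triples_eq_triplesFrom] at ha
    exact le_of_mem_triplesFrom ha

theorem ncard_orderedCarlitzWords_triples (n : ℕ) :
    ((orderedCarlitzWords (triples n)).ncard : ℚ) = factorialFunctional (unseenPoly n) := by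
  rw [orderedCarlitzWords_triples,
    (ncard_wordsFrom_and_wordsFromAfter _ 1 n 0 (by simp) rfl).1, seenPoly_zero, one_mul]

/-- Order forces the first letter to be 0. The tail has one 0 left and may not begin with it, whence
the factor ℓ_2' = X - 1. -/
theorem ncard_orderedCarlitzWords_replicate_two_add_triples (n : ℕ) :
    ((orderedCarlitzWords (Multiset.replicate 2 0 + triples n)).ncard : ℚ) =
      factorialFunctional ((X - 1) * unseenPoly n) := by
  have hM : Multiset.replicate 2 0 + triples n = 0 ::ₘ ({0} + triplesFrom 1 n) := by
    rw [triples_eq_triplesFrom, Multiset.replicate_succ, Multiset.replicate_one,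
      Multiset.cons_add]
  have hset : orderedCarlitzWords (Multiset.replicate 2 0 + triples n) =
      wordsFrom 0 (0 ::ₘ ({0} + triplesFrom 1 n)) := by
    ext w
    rw [hM]
    exact and_congr_right fun _ => and_congr_right fun _ => orderedFrom_zero.symm
  have hhead : ∀ w ∈ wordsFrom 0 (0 ::ₘ ({0} + triplesFrom 1 n)),
      ∃ b ∈ ({0} : Finset ℕ), ∃ v, w = b :: v := by
    rintro w ⟨h₁, -, h₃⟩
    cases w with
    | nil => exact absurd h₁.symm (Multiset.cons_ne_zero)
    | cons b v =>
      refine ⟨b, ?_, v, rfl⟩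
      rw [Finset.mem_singleton]
      by_contra hb
      have h0 : 0 ∈ ((b :: v : List ℕ) : Multiset ℕ) := by rw [h₁]; simp
      exact not_orderedFrom_cons_of_gt (Nat.pos_of_ne_zero hb)
        ((List.mem_cons.1 (Multiset.mem_coe.1 h0)).resolve_left (Ne.symm hb)) h₃
  have htails : {v | 0 :: v ∈ wordsFrom 0 (0 ::ₘ ({0} + triplesFrom 1 n))} =
      wordsFromAfter 1 0 ({0} + triplesFrom 1 n) := by
    ext v
    rw [Set.mem_ofPred_eq, cons_self_mem_wordsFrom, Multiset.erase_cons_head]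
    simp
  have hderiv : derivative (letterPoly 2) = X - 1 := by
    rw [derivative_letterPoly_succ, letterPoly_one, derivative_X]
  have herase : (Finset.range 1).erase 0 = ∅ := by decide
  rw [hset, ncard_eq_sum_ncard_tails (wordsFrom_finite _ _) {0} hhead, Finset.sum_singleton,
    htails, (ncard_wordsFrom_and_wordsFromAfter _ 1 n {0} (by simp) rfl).2 0 (by simp),
    Multiset.count_singleton_self, herase, hderiv, seenPoly, Finset.prod_empty, mul_one]

/-! ### The recurrences -/

theorem factorialFunctional_eq_derivative_mul_letterPoly_pow (R : ℚ[X]) (n : ℕ) :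
    factorialFunctional (R * letterPoly 3 ^ (n + 1)) =
      factorialFunctional (derivative R * letterPoly 3 ^ (n + 1) +
        R * (C (n + 1 : ℚ) * letterPoly 3 ^ n * derivative (letterPoly 3))) := by
  have h := factorialFunctional_derivative (R * letterPoly 3 ^ (n + 1))
  rw [derivative_mul, derivative_pow_succ] at h
  rw [h]
  simp [eval_zero_letterPoly]

theorem derivative_letterPoly_three :
    derivative (letterPoly 3) = C (1 / 2) * X ^ 2 - 2 * X + 1 := by
  rw [derivative_letterPoly_succ, derivative_letterPoly_succ, letterPoly_two, letterPoly_one,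
    derivative_X]
  ring

theorem factorialFunctional_C_mul (a : ℚ) (h : ℚ[X]) :
    factorialFunctional (C a * h) = a * factorialFunctional h := by
  rw [← smul_eq_C_mul, map_smul, smul_eq_mul]

/-- `ring` treats `C (1 / 6)` as an atom; this is the one relation on it that the polynomial
identities need. -/
theorem six_mul_C_one_div_six : (6 : ℚ[X]) * C (1 / 6) = 1 := by
  rw [← C_ofNat, ← C_mul]
  norm_num

theorem C_one_div_two_eq : (C (1 / 2) : ℚ[X]) = 3 * C (1 / 6) := by
  rw [← C_ofNat, ← C_mul]
  norm_num

theorem factorialFunctional_X_sub_one_mul_pow (n : ℕ) :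
    factorialFunctional ((X - 1) * letterPoly 3 ^ (n + 1)) =
      (3 * (n + 1 : ℚ) + 2) * factorialFunctional (letterPoly 3 ^ (n + 1)) +
        2 * (n + 1 : ℚ) * factorialFunctional ((X - 1) * letterPoly 3 ^ n) := by
  -- X - 2 is the quotient in the division 3P = (X - 2)P' - 2(X - 1).
  have h := factorialFunctional_eq_derivative_mul_letterPoly_pow (X - 2) n
  have key : (X - 1) * letterPoly 3 ^ (n + 1) -
      (C (3 * (n + 1 : ℚ) + 2) * letterPoly 3 ^ (n + 1) +
        C (2 * (n + 1 : ℚ)) * ((X - 1) * letterPoly 3 ^ n)) =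
      (X - 2) * letterPoly 3 ^ (n + 1) - (derivative (X - 2) * letterPoly 3 ^ (n + 1) +
        (X - 2) * (C (n + 1 : ℚ) * letterPoly 3 ^ n * derivative (letterPoly 3))) := by
    rw [derivative_letterPoly_three, pow_succ, letterPoly_three]
    generalize (C (1 / 6) * X ^ 3 - X ^ 2 + X : ℚ[X]) ^ n = F
    rw [C_one_div_two_eq]
    simp only [derivative_sub, derivative_X, derivative_ofNat, C_add, C_mul, C_ofNat, C_1]
    linear_combination (-(C (n : ℚ) + 1) * F * X ^ 2) * six_mul_C_one_div_six
  have := congrArg factorialFunctional key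
  rw [map_sub, map_sub, map_add, factorialFunctional_C_mul, factorialFunctional_C_mul, ← h,
    sub_self] at this
  exact sub_eq_zero.1 this

theorem two_mul_factorialFunctional_pow (n : ℕ) :
    2 * factorialFunctional (letterPoly 3 ^ (n + 2)) =
      (n + 2 : ℚ) * ((3 * (n + 1 : ℚ) + 3) *
          factorialFunctional ((X - 1) * letterPoly 3 ^ (n + 1)) -
        2 * (3 * (n + 1 : ℚ) + 1) * factorialFunctional (letterPoly 3 ^ (n + 1)) +
        2 * (n + 1 : ℚ) * factorialFunctional (letterPoly 3 ^ n)) := by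
  -- The quadratic S = X² - 5X + 2 comes from the Bézout identity SP' - 3(X - 3)P = 2; it also
  -- satisfies S - S' - 2P' = 5 - 3X. The summand 2P supplies the term P^{n+2}.
  have h := factorialFunctional_eq_derivative_mul_letterPoly_pow
    (2 * letterPoly 3 + C (n + 2 : ℚ) * (X ^ 2 - 5 * X + 2)) n
  have key : C 2 * letterPoly 3 ^ (n + 2) -
      C (n + 2 : ℚ) * (C (3 * (n + 1 : ℚ) + 3) * ((X - 1) * letterPoly 3 ^ (n + 1)) -
        C (2 * (3 * (n + 1 : ℚ) + 1)) * letterPoly 3 ^ (n + 1) +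
        C (2 * (n + 1 : ℚ)) * letterPoly 3 ^ n) =
      (2 * letterPoly 3 + C (n + 2 : ℚ) * (X ^ 2 - 5 * X + 2)) * letterPoly 3 ^ (n + 1) -
      (derivative (2 * letterPoly 3 + C (n + 2 : ℚ) * (X ^ 2 - 5 * X + 2)) *
          letterPoly 3 ^ (n + 1) +
        (2 * letterPoly 3 + C (n + 2 : ℚ) * (X ^ 2 - 5 * X + 2)) *
          (C (n + 1 : ℚ) * letterPoly 3 ^ n * derivative (letterPoly 3))) := by
    have hd : derivative (2 * letterPoly 3 + C (n + 2 : ℚ) * (X ^ 2 - 5 * X + 2)) =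
        2 * derivative (letterPoly 3) + C (n + 2 : ℚ) * (2 * X - 5) := by
      have h2 : derivative (2 : ℚ[X]) = 0 := derivative_ofNat 2
      have h5 : derivative (5 : ℚ[X]) = 0 := derivative_ofNat 5
      rw [derivative_add, derivative_mul, derivative_C_mul, derivative_add, derivative_sub,
        derivative_mul, derivative_X_sq, derivative_X, h2, h5, C_ofNat]
      ring
    rw [hd, derivative_letterPoly_three, pow_succ, pow_succ, letterPoly_three]
    generalize (C (1 / 6) * X ^ 3 - X ^ 2 + X : ℚ[X]) ^ n = F
    rw [C_one_div_two_eq]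
    simp only [C_add, C_mul, C_ofNat, C_1]
    linear_combination (F * (C (n : ℚ) + 2) * ((C (n : ℚ) + 1) * X ^ 2 - C (n : ℚ) * X ^ 3 - X ^ 4
      + C (1 / 6) * X ^ 5)) * six_mul_C_one_div_six
  have := congrArg factorialFunctional key
  rw [map_sub, map_sub, ← h, sub_self, factorialFunctional_C_mul, factorialFunctional_C_mul,
    map_add factorialFunctional, map_sub factorialFunctional, factorialFunctional_C_mul,
    factorialFunctional_C_mul, factorialFunctional_C_mul] at this
  exact sub_eq_zero.1 this

theorem ncard_orderedCarlitzWords_eq_div (n : ℕ) :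
    ((orderedCarlitzWords (triples n)).ncard : ℚ) =
      (n.factorial : ℚ)⁻¹ * factorialFunctional (letterPoly 3 ^ n) := by
  rw [ncard_orderedCarlitzWords_triples, unseenPoly, factorialFunctional_C_mul]

theorem ncard_orderedCarlitzWords_replicate_two_eq_div (n : ℕ) :
    ((orderedCarlitzWords (Multiset.replicate 2 0 + triples n)).ncard : ℚ) =
      (n.factorial : ℚ)⁻¹ * factorialFunctional ((X - 1) * letterPoly 3 ^ n) := by
  rw [ncard_orderedCarlitzWords_replicate_two_add_triples, unseenPoly, mul_left_comm,
    factorialFunctional_C_mul]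

theorem orderedCarlitzWords_replicate_two_recurrence (n : ℕ) :
    ((orderedCarlitzWords (Multiset.replicate 2 0 + triples (n + 1))).ncard : ℚ) =
      (3 * ((n + 1 : ℕ) : ℚ) + 2) * ((orderedCarlitzWords (triples (n + 1))).ncard : ℚ) +
        2 * ((orderedCarlitzWords (Multiset.replicate 2 0 + triples n)).ncard : ℚ) := by
  simp only [ncard_orderedCarlitzWords_eq_div, ncard_orderedCarlitzWords_replicate_two_eq_div,
    factorialFunctional_X_sub_one_mul_pow n, Nat.factorial_succ]
  have : (n.factorial : ℚ) ≠ 0 := by positivity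
  have : (n + 1 : ℚ) ≠ 0 := by positivity
  push_cast
  field_simp

theorem orderedCarlitzWords_triples_recurrence (n : ℕ) :
    2 * ((orderedCarlitzWords (triples (n + 2))).ncard : ℚ) =
      (3 * ((n + 1 : ℕ) : ℚ) + 3) *
          ((orderedCarlitzWords (Multiset.replicate 2 0 + triples (n + 1))).ncard : ℚ) -
        2 * (3 * ((n + 1 : ℕ) : ℚ) + 1) * ((orderedCarlitzWords (triples (n + 1))).ncard : ℚ) +
        2 * ((orderedCarlitzWords (triples n)).ncard : ℚ) := by
  simp only [ncard_orderedCarlitzWords_eq_div, ncard_orderedCarlitzWords_replicate_two_eq_div]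
  rw [mul_left_comm, two_mul_factorialFunctional_pow n, Nat.factorial_succ (n + 1),
    Nat.factorial_succ n]
  have : (n.factorial : ℚ) ≠ 0 := by positivity
  have : (n + 1 : ℚ) ≠ 0 := by positivity
  have : (n + 2 : ℚ) ≠ 0 := by positivity
  have : (n + 1 + 1 : ℚ) ≠ 0 := by positivity
  push_cast
  field_simp
  ring

/-! ### Initial values and the equivalence -/

theorem ncard_orderedCarlitzWords_triples_zero :
    ((orderedCarlitzWords (triples 0)).ncard : ℚ) = 1 := by
  simp [ncard_orderedCarlitzWords_eq_div, factorialFunctional_one]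

theorem ncard_orderedCarlitzWords_triples_one :
    ((orderedCarlitzWords (triples 1)).ncard : ℚ) = 0 := by
  rw [ncard_orderedCarlitzWords_eq_div, pow_one, letterPoly_three, C_mul_X_pow_eq_monomial,
    X_pow_eq_monomial, ← monomial_one_one_eq_X, map_add, map_sub, factorialFunctional_monomial,
    factorialFunctional_monomial, factorialFunctional_monomial]
  norm_num [Nat.factorial]

theorem ncard_orderedCarlitzWords_replicate_two_zero :
    ((orderedCarlitzWords (Multiset.replicate 2 0 + triples 0)).ncard : ℚ) = 0 := by
  rw [ncard_orderedCarlitzWords_replicate_two_eq_div, pow_zero, mul_one, map_sub,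
    factorialFunctional_one, ← monomial_one_one_eq_X, factorialFunctional_monomial]
  norm_num

theorem mainTheorem4 (p q : ℕ → ℚ) :
    (p 0 = 1 ∧ p 1 = 0 ∧ q 0 = 0 ∧
      (∀ n : ℕ, 1 ≤ n →
        2 * p (n + 1) = (3 * (n : ℚ) + 3) * q n - 2 * (3 * (n : ℚ) + 1) * p n
          + 2 * p (n - 1)) ∧
      (∀ n : ℕ, 1 ≤ n → q n = (3 * (n : ℚ) + 2) * p n + 2 * q (n - 1))) ↔
    (∀ n : ℕ,
      p n = ((orderedCarlitzWords (triples n)).ncard : ℚ) ∧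
      q n = ((orderedCarlitzWords (Multiset.replicate 2 0 + triples n)).ncard : ℚ)) := by
  constructor
  · rintro ⟨hp0, hp1, hq0, hp, hq⟩
    -- The recurrence for `p` has order two and that for `q` at n + 1 uses `p (n + 1)`, so the
    -- induction also carries `p (n + 1)`.
    have hind : ∀ n : ℕ,
        p n = ((orderedCarlitzWords (triples n)).ncard : ℚ) ∧
        q n = ((orderedCarlitzWords (Multiset.replicate 2 0 + triples n)).ncard : ℚ) ∧
        p (n + 1) = ((orderedCarlitzWords (triples (n + 1))).ncard : ℚ) := by
      intro n
      induction n with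
      | zero =>
        exact ⟨hp0.trans ncard_orderedCarlitzWords_triples_zero.symm,
          hq0.trans ncard_orderedCarlitzWords_replicate_two_zero.symm,
          hp1.trans ncard_orderedCarlitzWords_triples_one.symm⟩
      | succ n ih =>
        obtain ⟨ih₁, ih₂, ih₃⟩ := ih
        have hq' := hq (n + 1) (Nat.le_add_left 1 n)
        rw [Nat.add_sub_cancel, ih₂, ih₃, ← orderedCarlitzWords_replicate_two_recurrence] at hq'
        have hp' := hp (n + 1) (Nat.le_add_left 1 n)
        rw [Nat.add_sub_cancel, ih₁, ih₃, hq', ← orderedCarlitzWords_triples_recurrence] at hp'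
        exact ⟨ih₃, hq', mul_left_cancel₀ two_ne_zero hp'⟩
    exact fun n => ⟨(hind n).1, (hind n).2.1⟩
  · intro h
    refine ⟨(h 0).1.trans ncard_orderedCarlitzWords_triples_zero,
      (h 1).1.trans ncard_orderedCarlitzWords_triples_one,
      (h 0).2.trans ncard_orderedCarlitzWords_replicate_two_zero, ?_, ?_⟩
    · intro n hn
      obtain ⟨n, rfl⟩ := Nat.exists_eq_add_of_le' hn
      rw [Nat.add_sub_cancel, (h _).1, (h _).1, (h _).1, (h _).2]
      exact orderedCarlitzWords_triples_recurrence n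
    · intro n hn
      obtain ⟨n, rfl⟩ := Nat.exists_eq_add_of_le' hn
      rw [Nat.add_sub_cancel, (h _).1, (h _).2, (h _).2]
      exact orderedCarlitzWords_replicate_two_recurrence n
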